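/- Let $k$ be a field and let $A$ be a (unital, associative) $k$-algebra such that $A$ has projective dimension at most $1$ as a module over its enveloping algebra $A^e = A\otimes_k A^{\mathrm{op}}$. Let $x\in A$ be normal (that is, $Ax = xA$) and not a zero divisor (neither $ax=0$ nor $xa=0$ for any nonzero $a\in A$), and let $\alpha$ be a $k$-algebra automorphism of $A$ such that $ax = x\alpha(a)$ for all $a\in A$. Put $I=(x)$ and $B=A/I$, and assume that $\alpha^n=\mathrm{id}_A$ for some integer $n\ge 1$. For a $B$-bimodule $M$ (that is, a left $B^e$-module) write $H^p(B,M)=\operatorname{Ext}^p_{B^e}(B,M)$ for Hochschild cohomology, and $HH^p(B)=H^p(B,B)$. Cup products with classes in $HH^*(B)$ are Yoneda products: for $\sigma\in H^p(B,M)$ and $\xi\in HH^d(B)$, $\sigma\smile\xi=\sigma\circ\xi\in H^{p+d}(B,M)$. They make $HH^*(B)=\bigoplus_{p\ge0}HH^p(B)$ a $k$-algebra and $H^*(B,M)=\bigoplus_{p\ge0}H^p(B,M)$ an $HH^*(B)$-module. Then: (1) There is a class $\xi\in HH^{2n}(B)$ such that, for all $p\ge1$ and all $B$-bimodules $M$,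 the $k$-linear map $(-)\smile\xi : H^p(B,M)\to H^{p+2n}(B,M)$ is an isomorphism. (2) If $\dim_k B<\infty$, then $HH^*(B)$ is a finitely generated $k$-algebra, and $H^*(B,M)$ is a finitely generated $HH^*(B)$-module for every $B$-bimodule $M$ with $\dim_k M<\infty$. -/

import Mathlib

open CategoryTheory CategoryTheory.Abelian
open scoped TensorProduct DirectSum ModuleCat

universe v u

noncomputable section

/-! ### Yoneda algebras and Yoneda modules -/

section Yoneda

universe w' v' u' t

variable {C : Type u'} [Category.{v'} C] [Abelian C] [HasExt.{w'} C]

theorem yoneda_mk_comp {X Y Z : C} {a b c : ℕ} (x : Ext X Y a) (y : Ext Y Z b) (h : a + b = c) :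
    (GradedMonoid.mk (A := Ext X Z) c (x.comp y h)) = GradedMonoid.mk (a + b) (x.comp y rfl) := by
  subst h; rfl

/-- The unit of the Yoneda algebra `Ext X X`. -/
instance yonedaGOne (X : C) : GradedMonoid.GOne (Ext X X) where
  one := Ext.mk₀ (𝟙 X)

/-- The product on `Ext X X`: the Yoneda product, written in diagrammatic order,
so that `a * b` is the composite `X → X[i] → X[i + j]` of `a` followed by `b`, that is, `b ∘ a`. -/
instance yonedaGMul (X : C) : GradedMonoid.GMul (Ext X X) where
  mul a b := a.comp b rfl

/-- The graded ring structure on `Ext X X`. -/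
instance yonedaGRing (X : C) : DirectSum.GRing (Ext X X) where
  __ := yonedaGOne X
  __ := yonedaGMul X
  mul_zero a := a.comp_zero X _ _ rfl
  zero_mul b := Ext.zero_comp X _ b _ rfl
  mul_add a b c := a.comp_add b c rfl
  add_mul a b c := Ext.add_comp a b c rfl
  one_mul := fun ⟨i, a⟩ => by
    refine (yoneda_mk_comp (Ext.mk₀ (𝟙 X)) a (zero_add i)).symm.trans ?_
    rw [Ext.mk₀_id_comp]; rfl
  mul_one := fun ⟨i, a⟩ => by
    refine (yoneda_mk_comp a (Ext.mk₀ (𝟙 X)) (add_zero i)).symm.trans ?_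
    rw [Ext.comp_mk₀_id]; rfl
  mul_assoc := fun ⟨i, a⟩ ⟨j, b⟩ ⟨l, c⟩ => by
    refine Eq.trans ?_ (yoneda_mk_comp a (b.comp c rfl) (add_assoc i j l).symm)
    exact congrArg (GradedMonoid.mk (i + j + l)) (Ext.comp_assoc a b c rfl rfl rfl)
  natCast n := n • Ext.mk₀ (𝟙 X)
  natCast_zero := zero_nsmul _
  natCast_succ n := succ_nsmul _ n
  intCast n := n • Ext.mk₀ (𝟙 X)
  intCast_ofNat n := natCast_zsmul _ n
  intCast_negSucc_ofNat n := negSucc_zsmul _ n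

/-- For an `R`-linear category, the Yoneda algebra is an `R`-algebra. -/
instance yonedaGAlgebra {R : Type t} [CommRing R] [Linear R C] (X : C) :
    DirectSum.GAlgebra R (Ext X X) where
  toFun :=
    { toFun := fun r => r • Ext.mk₀ (𝟙 X)
      map_zero' := zero_smul _ _
      map_add' := fun r s => add_smul r s _ }
  map_one := one_smul _ _
  map_mul r s := by
    refine Eq.trans ?_ (yoneda_mk_comp (r • Ext.mk₀ (𝟙 X)) (s • Ext.mk₀ (𝟙 X)) (zero_add 0))
    simp [mul_smul, smul_comm r s]
  commutes := fun r ⟨i, a⟩ => by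
    refine (yoneda_mk_comp (r • Ext.mk₀ (𝟙 X)) a (zero_add i)).symm.trans
      (Eq.trans ?_ (yoneda_mk_comp a (r • Ext.mk₀ (𝟙 X)) (add_zero i)))
    simp
  smul_def := fun r ⟨i, a⟩ => by
    refine Eq.trans ?_ (yoneda_mk_comp (r • Ext.mk₀ (𝟙 X)) a (zero_add i))
    rw [Ext.smul_comp, Ext.mk₀_id_comp]
    rfl

/-- The graded module structure on `Ext X Y` over the graded ring `Ext X X`: an element `a` acts by
precomposition, `σ ↦ σ ∘ a`. -/
instance yonedaGmodule (X Y : C) : DirectSum.Gmodule (Ext X X) (Ext X Y) where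
  smul a s := a.comp s rfl
  smul_zero a := a.comp_zero Y _ _ rfl
  zero_smul b := Ext.zero_comp X _ b _ rfl
  smul_add a b c := a.comp_add b c rfl
  add_smul a b c := Ext.add_comp a b c rfl
  one_smul := fun ⟨i, a⟩ => by
    refine (yoneda_mk_comp (Ext.mk₀ (𝟙 X)) a (zero_add i)).symm.trans ?_
    rw [Ext.mk₀_id_comp]; rfl
  mul_smul := fun ⟨i, a⟩ ⟨j, b⟩ ⟨l, c⟩ => by
    refine Eq.trans ?_ (yoneda_mk_comp a (b.comp c rfl) (add_assoc i j l).symm)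
    exact congrArg (GradedMonoid.mk (i + j + l)) (Ext.comp_assoc a b c rfl rfl rfl)

end Yoneda

/-! ### Hochschild cohomology -/

section Hochschild

variable (k : Type v) [Field k] (A : Type u) [Ring A] [Algebra k A]

/-- The enveloping algebra `A ⊗ Aᵒᵖ`. -/
abbrev EnvelopingAlgebra : Type u := A ⊗[k] Aᵐᵒᵖ

/-- The category of `A`-bimodules (on which `k` acts centrally), as the category of left modules
over the enveloping algebra. -/
abbrev BimoduleCat : Type (u + 1) := ModuleCat.{u} (EnvelopingAlgebra k A)

/-- The regular bimodule `A`, with `(a ⊗ b) • x = a * x * b`. -/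
def regularBimodule : BimoduleCat k A :=
  letI : Module (EnvelopingAlgebra k A) A := instModuleTensorProductMop k A
  ModuleCat.of (EnvelopingAlgebra k A) A

/-- Hochschild cohomology `H^p(A, M) = Ext^p(A, M)` over the enveloping algebra. -/
abbrev HochschildCohomology (M : BimoduleCat k A) (p : ℕ) : Type u :=
  Ext (regularBimodule k A) M p

/-- `HH^p(A) = H^p(A, A)`. -/
abbrev HH (p : ℕ) : Type u := HochschildCohomology k A (regularBimodule k A) p

/-- The Hochschild cohomology algebra `HH^*(A)`, with the Yoneda (cup) product. The product is
written in diagrammatic order, so that `H^*(A, M)`, on which `ξ` acts by `σ ↦ σ ∘ ξ`, is a left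
module; `HH^*(A)` is graded commutative, so the opposite order gives the same products up to
sign. -/
abbrev HHAlgebra : Type u := ⨁ p, HH k A p

/-- The `HH^*(A)`-module `H^*(A, M)`. -/
abbrev HochschildModule (M : BimoduleCat k A) : Type u := ⨁ p, HochschildCohomology k A M p

variable {k A}

/-- The product `σ ↦ σ ⌣ ξ` with a class `ξ ∈ HH^d(A)`, that is, the Yoneda product `σ ∘ ξ`, as a
`k`-linear map `H^p(A, M) → H^{p+d}(A, M)`. -/
def cupWith {d : ℕ} (ξ : HH k A d) (M : BimoduleCat k A) (p : ℕ) :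
    HochschildCohomology k A M p →ₗ[k] HochschildCohomology k A M (p + d) :=
  ξ.precompOfLinear k M (add_comm d p)

end Hochschild

/-- An element `x` is normal if `A x = x A`. -/
def IsNormalElement {A : Type u} [Ring A] (x : A) : Prop :=
  Set.range (fun a : A => a * x) = Set.range (fun a : A => x * a)

/-- The quotient `A / (x)` by the two-sided ideal generated by `x`. -/
abbrev QuotientBy {A : Type u} [Ring A] (x : A) : Type u :=
  (TwoSidedIdeal.span {x}).ringCon.Quotient

end

/-!
Write `Aᵉ = A ⊗ Aᵒᵖ`, `I = (x)`, `B = A / I`, `Bᵉ = B ⊗ Bᵒᵖ`, and let `J` be the kernel of the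
multiplication map `Aᵉ → A`. Since `A` has projective dimension at most one, `J` is a projective
left ideal (`projective_envKer`). Let `K` be the kernel of `Aᵉ → Bᵉ`. Then `P = J / K J` is a
projective `Bᵉ`-module (`exists_projective_baseChange`), and the inclusion `J → Aᵉ` induces a map
`P → Bᵉ` whose image is the kernel of the multiplication `Bᵉ → B`. The kernel `(J ∩ K) / K J` of
this map is cyclic, generated by the class of `x ⊗ 1 - 1 ⊗ x`
(`exists_sub_mul_envCommutator_mem`), and an element `a` of `Aᵉ` annihilates this generator exactly
when multiplication sends `(α ⊗ 1)(a)` into `I` (`mul_envCommutator_mem_iff`). So there is an exact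
sequence of bimodules `0 → B' → P → Bᵉ → B → 0`, where `B'` is `B` with its left action twisted by
the automorphism induced by `α`.

Twisting by an automorphism is an autoequivalence of the category of bimodules, so the twists of
this sequence are exact with projective middle terms, and `n` of them can be spliced. As `αⁿ = 1`,
the result is an exact sequence of length `2n` from `B` to `B`, and composition with its class `ξ`
is a composite of connecting homomorphisms of long exact `Ext` sequences with projective middle
term, hence is bijective in positive degrees (`hasPeriodicityClass_twist_pow`).

If `B` is finite-dimensional, then so is every `Ext` group between finite-dimensional bimodules
(`finite_ext_of_finite_algebra`). As every class of degree above `2n` is a multiple of `ξ`, the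
Hochschild cohomology is generated in degrees at most `2n`, by finitely many classes
(`finiteType_yoneda`, `finite_yonedaModule`).
-/

/-! ### Projective modules and surjective change of rings -/

/-- Base change of a projective module `J` along a surjection `f : R → S`: the quotient
`J / (ker f) J`, which is `S ⊗ J`, is a projective `S`-module. It is described by the semilinear
quotient map `q`, because `S` and `R` need not be commutative. -/
theorem exists_projective_baseChange {R S J : Type u} [Ring R] [Ring S] (f : R →+* S)
    (hf : Function.Surjective f) [AddCommGroup J] [Module R J] [Module.Projective R J] :
    ∃ (P : Type u) (_ : AddCommGroup P) (_ : Module S P) (q : J →ₛₗ[f] P),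
      Module.Projective S P ∧ Function.Surjective q ∧
        ∀ j, q j = 0 ↔ j ∈ RingHom.ker f • (⊤ : Submodule R J) := by
  let N : Submodule R J := RingHom.ker f • ⊤
  have kill : ∀ (c : R), f c = 0 → ∀ y : J ⧸ N, c • y = 0 := by
    intro c hc y
    obtain ⟨j, rfl⟩ := N.mkQ_surjective y
    rw [← map_smul, Submodule.mkQ_apply, Submodule.Quotient.mk_eq_zero]
    exact Submodule.smul_mem_smul hc trivial
  let _ : SMul S (J ⧸ N) := ⟨fun s y => Function.surjInv hf s • y⟩
  have hsmul : ∀ (c : R) (y : J ⧸ N), f c • y = c • y := by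
    intro c y
    change Function.surjInv hf (f c) • y = c • y
    rw [← sub_eq_zero, ← sub_smul]
    exact kill _ (by rw [map_sub, Function.surjInv_eq hf, sub_self]) y
  let _ : Module S (J ⧸ N) := hf.moduleLeft f hsmul
  let q : J →ₛₗ[f] J ⧸ N :=
    { toFun := N.mkQ
      map_add' := map_add _
      map_smul' := fun r j => by rw [hsmul, map_smul] }
  have hq : ∀ j, q j = 0 ↔ j ∈ N := fun j => Submodule.Quotient.mk_eq_zero N
  refine ⟨J ⧸ N, inferInstance, inferInstance, q, ?_, N.mkQ_surjective, hq⟩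
  refine Module.Projective.of_lifting_property fun {X Y} _ _ _ _ g h hg => ?_
  let _ : Module R X := Module.compHom X f
  let _ : Module R Y := Module.compHom Y f
  let g' : X →ₗ[R] Y :=
    { toFun := g, map_add' := map_add _, map_smul' := fun r y => map_smul g (f r) y }
  let h' : J →ₗ[R] Y :=
    { toFun := fun j => h (q j)
      map_add' := by simp
      map_smul' := fun r j => by
        rw [map_smulₛₗ, map_smul]; rfl }
  obtain ⟨l, hl⟩ := Module.projective_lifting_property g' h' hg
  have hlN : N ≤ LinearMap.ker l := by
    refine Submodule.smul_le.2 fun r hr j _ => ?_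
    rw [LinearMap.mem_ker, map_smul]
    change f r • l j = 0
    rw [RingHom.mem_ker.1 hr, zero_smul]
  let m : J ⧸ N →ₗ[S] X :=
    { toFun := N.liftQ l hlN
      map_add' := map_add (N.liftQ l hlN)
      map_smul' := fun s y => by
        obtain ⟨r, rfl⟩ := hf s
        rw [hsmul]
        exact map_smul (N.liftQ l hlN) r y }
  refine ⟨m, LinearMap.ext fun y => ?_⟩
  obtain ⟨j, rfl⟩ := N.mkQ_surjective y
  exact LinearMap.congr_fun hl j

/-- Let `J` be a projective left ideal of `R` and `f : R → S` a surjection with kernel `K`. If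
`(J ∩ K) / K J` is generated by the class of `e`, with annihilator `L` in `S`, then there is an
exact sequence `0 → S / L → P → S` with `P` projective, in which the image of `P → S` is `f(J)`. -/
theorem exists_presentation_baseChange {R S : Type u} [Ring R] [Ring S] (f : R →+* S)
    (hf : Function.Surjective f) (J : Submodule R R) [Module.Projective R J] (e : R) (he : e ∈ J)
    (hfe : f e = 0) (L : Submodule S S)
    (h₁ : ∀ u ∈ J, f u = 0 → ∃ a, u - a * e ∈ RingHom.ker f • J)
    (h₂ : ∀ a, a * e ∈ RingHom.ker f • J ↔ f a ∈ L) :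
    ∃ (P : Type u) (_ : AddCommGroup P) (_ : Module S P) (φ : P →ₗ[S] S) (ψ : S →ₗ[S] P),
      Module.Projective S P ∧ (∀ s, s ∈ LinearMap.range φ ↔ ∃ u ∈ J, f u = s) ∧
        LinearMap.range ψ = LinearMap.ker φ ∧ LinearMap.ker ψ = L := by
  obtain ⟨P, _, _, q, hP, hq, hq0⟩ := exists_projective_baseChange (J := J) f hf
  have hN : ∀ j : J, q j = 0 ↔ (j : R) ∈ RingHom.ker f • J := by
    intro j
    have h : (RingHom.ker f • (⊤ : Submodule R J)).map J.subtype = RingHom.ker f • J := by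
      rw [Submodule.map_smul'', Submodule.map_subtype_top]
    rw [hq0, ← h, Submodule.mem_map]
    exact ⟨fun hj => ⟨j, hj, rfl⟩, fun ⟨i, hi, hij⟩ => Subtype.ext hij ▸ hi⟩
  have hφ : ∀ j j' : J, q j = q j' → f j = f j' := by
    intro j j' h
    rw [← sub_eq_zero, ← map_sub, hN] at h
    have hle : RingHom.ker f • J ≤ RingHom.ker f := by
      refine Submodule.smul_le.2 fun r hr j _ => ?_
      rw [RingHom.mem_ker] at hr ⊢
      rw [smul_eq_mul, map_mul, hr, zero_mul]
    have := RingHom.mem_ker.1 (hle h)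
    rwa [Submodule.coe_sub, map_sub, sub_eq_zero] at this
  -- The inclusion of `J` into `R` descends to `φ : P → S`; it is evaluated on chosen preimages.
  choose σ hσ using hq
  have hs : ∀ j, f (σ (q j)) = f j := fun j => hφ _ _ (hσ _)
  let φ : P →ₗ[S] S :=
    { toFun := fun p => f (σ p)
      map_add' := fun p p' => by
        obtain ⟨j, rfl⟩ : ∃ j, q j = p := ⟨_, hσ p⟩
        obtain ⟨j', rfl⟩ : ∃ j, q j = p' := ⟨_, hσ p'⟩
        rw [← map_add, hs, hs, hs, Submodule.coe_add, map_add]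
      map_smul' := fun s p => by
        obtain ⟨j, rfl⟩ : ∃ j, q j = p := ⟨_, hσ p⟩
        obtain ⟨r, rfl⟩ := hf s
        rw [← map_smulₛₗ, hs, hs, Submodule.coe_smul, smul_eq_mul, map_mul]; rfl }
  have hφq : ∀ j, φ (q j) = f j := hs
  have hψ : ∀ a, LinearMap.toSpanSingleton S P (q ⟨e, he⟩) (f a) = q (a • ⟨e, he⟩) := fun a => by
    rw [LinearMap.toSpanSingleton_apply, map_smulₛₗ]
  refine ⟨P, _, _, φ, LinearMap.toSpanSingleton S P (q ⟨e, he⟩), hP, ?_, ?_, ?_⟩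
  · intro s
    constructor
    · rintro ⟨p, rfl⟩
      obtain ⟨j, rfl⟩ : ∃ j, q j = p := ⟨_, hσ p⟩
      exact ⟨j, j.2, (hφq j).symm⟩
    · rintro ⟨u, hu, rfl⟩
      exact ⟨q ⟨u, hu⟩, hφq _⟩
  · apply le_antisymm
    · rintro _ ⟨s, rfl⟩
      obtain ⟨a, rfl⟩ := hf s
      rw [LinearMap.mem_ker, hψ, hφq, Submodule.coe_smul, smul_eq_mul, map_mul, hfe, mul_zero]
    · intro p hp
      obtain ⟨j, rfl⟩ : ∃ j, q j = p := ⟨_, hσ p⟩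
      rw [LinearMap.mem_ker, hφq] at hp
      obtain ⟨a, ha⟩ := h₁ j j.2 hp
      refine ⟨f a, ?_⟩
      rw [hψ, eq_comm, ← sub_eq_zero, ← map_sub, hN]
      exact ha
  · ext s
    obtain ⟨a, rfl⟩ := hf s
    rw [LinearMap.mem_ker, hψ, hN, ← h₂]
    rfl

/-! ### Syzygies and periodicity classes -/

section Syzygy
universe w' v' u'
variable {C : Type u'} [Category.{v'} C] [Abelian C]

/-- `Y` is a syzygy of `X`: there is a short exact sequence `0 → Y → P → X → 0` with `P`
projective. -/
def IsSyzygy (X Y : C) : Prop :=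
  ∃ (P : C) (f : Y ⟶ P) (g : P ⟶ X) (w : f ≫ g = 0),
    Projective P ∧ (ShortComplex.mk f g w).ShortExact

theorem IsSyzygy.map {X Y : C} (h : IsSyzygy X Y) {D : Type u'} [Category.{v'} D] [Abelian D]
    (F : C ⥤ D) [F.IsEquivalence] [F.PreservesZeroMorphisms] : IsSyzygy (F.obj X) (F.obj Y) := by
  obtain ⟨P, f, g, w, hP, hS⟩ := h
  exact ⟨F.obj P, F.map f, F.map g, by rw [← F.map_comp, w, F.map_zero],
    (F.asEquivalence.map_projective_iff P).2 hP, hS.map_of_exact F⟩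

variable [HasExt.{w'} C]

/-- There is a class in `Ext X Y d` such that composition with it is bijective on `Ext` in all
positive degrees. -/
def HasPeriodicityClass (X Y : C) (d : ℕ) : Prop :=
  ∃ ξ : Ext X Y d, ∀ (p q : ℕ) (h : d + p = q), 1 ≤ p → ∀ M : C,
    Function.Bijective fun s : Ext Y M p => ξ.comp s h

theorem HasPeriodicityClass.of_iso {X Y : C} (i : X ≅ Y) : HasPeriodicityClass X Y 0 := by
  refine ⟨Ext.mk₀ i.hom, fun p q h _ M => ?_⟩
  obtain rfl : p = q := by omega
  refine Function.bijective_iff_has_inverse.2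
    ⟨fun s => (Ext.mk₀ i.inv).comp s (zero_add p), fun s => ?_, fun s => ?_⟩ <;> simp

theorem HasPeriodicityClass.trans {X Y Z : C} {a b c : ℕ} (h₁ : HasPeriodicityClass X Y a)
    (h₂ : HasPeriodicityClass Y Z b) (hc : a + b = c) : HasPeriodicityClass X Z c := by
  obtain ⟨ξ, hξ⟩ := h₁
  obtain ⟨η, hη⟩ := h₂
  refine ⟨ξ.comp η hc, fun p q h hp M => ?_⟩
  have : (fun s : Ext Z M p => (ξ.comp η hc).comp s h) =
      (fun s => ξ.comp s (by omega : a + (b + p) = q)) ∘ fun s => η.comp s rfl := by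
    funext s
    exact Ext.comp_assoc ξ η s hc rfl (by omega)
  rw [this]
  exact (hξ _ _ _ (by omega) M).comp (hη _ _ _ hp M)

/-- The class of a short exact sequence with projective middle term is a periodicity class, by the
long exact sequence of `Ext`. -/
theorem IsSyzygy.hasPeriodicityClass {X Y : C} (h : IsSyzygy X Y) :
    HasPeriodicityClass X Y 1 := by
  obtain ⟨P, f, g, w, hP, hS⟩ := h
  refine ⟨hS.extClass, fun p q h hp M => ⟨?_, fun s => ?_⟩⟩
  · have : Function.Injective (hS.extClass.precomp M h) := by
      refine (injective_iff_map_eq_zero _).2 fun s hs => ?_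
      obtain ⟨t, rfl⟩ := Ext.contravariant_sequence_exact₁ hS M s h hs
      obtain ⟨p, rfl⟩ := Nat.exists_eq_add_of_le' hp
      have : t = 0 := Ext.eq_zero_of_projective t
      rw [this, Ext.comp_zero]
    exact this
  · obtain ⟨q, rfl⟩ : ∃ q', q = q' + 1 := ⟨p, by omega⟩
    exact Ext.contravariant_sequence_exact₃ hS M s (Ext.eq_zero_of_projective _) h

end Syzygy

/-- A surjection from a projective module together with an injection onto its kernel exhibits a
syzygy. -/
theorem IsSyzygy.of_linearMap {S : Type u} [Ring S] {X Y P : Type u} [AddCommGroup X]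
    [AddCommGroup Y] [AddCommGroup P] [Module S X] [Module S Y] [Module S P] [Module.Projective S P]
    (ι : Y →ₗ[S] P) (g : P →ₗ[S] X) (hι : Function.Injective ι) (hg : Function.Surjective g)
    (h : LinearMap.range ι = LinearMap.ker g) : IsSyzygy (ModuleCat.of S X) (ModuleCat.of S Y) := by
  refine ⟨ModuleCat.of S P, ModuleCat.ofHom ι, ModuleCat.ofHom g, ?_,
    (IsProjective.iff_projective P).1 inferInstance, ?_⟩
  · ext y
    exact LinearMap.mem_ker.1 (h.le (LinearMap.mem_range_self ι y))
  · exact ModuleCat.shortComplex_shortExact _ (LinearMap.exact_iff.2 h.symm) hι hg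

/-- An exact sequence `0 → Y → P → S → X → 0` with `P` projective exhibits `Y` as a second syzygy
of `X`. The map `Y → P` is given by its composite `ψ` with a surjection `h : S → Y`. -/
theorem exists_isSyzygy_isSyzygy {S : Type u} [Ring S] {X Y P : Type u} [AddCommGroup X]
    [AddCommGroup Y] [AddCommGroup P] [Module S X] [Module S Y] [Module S P] [Module.Projective S P]
    (g : S →ₗ[S] X) (φ : P →ₗ[S] S) (ψ : S →ₗ[S] P) (h : S →ₗ[S] Y)
    (hg : Function.Surjective g) (hh : Function.Surjective h)
    (hφ : LinearMap.range φ = LinearMap.ker g) (hψ : LinearMap.range ψ = LinearMap.ker φ)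
    (hker : LinearMap.ker ψ = LinearMap.ker h) :
    ∃ Z, IsSyzygy (ModuleCat.of S X) Z ∧ IsSyzygy Z (ModuleCat.of S Y) := by
  refine ⟨ModuleCat.of S (LinearMap.range φ),
    .of_linearMap (LinearMap.range φ).subtype g Subtype.val_injective hg (by simpa using hφ), ?_⟩
  let ι : Y →ₗ[S] P := (LinearMap.ker h).liftQ ψ hker.ge ∘ₗ
    (h.quotKerEquivOfSurjective hh).symm.toLinearMap
  have hι : ∀ s, ι (h s) = ψ s := fun s => by
    simp [ι]
  refine .of_linearMap ι φ.rangeRestrict ?_ φ.surjective_rangeRestrict ?_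
  · refine (injective_iff_map_eq_zero _).2 fun y hy => ?_
    obtain ⟨s, rfl⟩ := hh y
    rwa [hι, ← LinearMap.mem_ker, hker, LinearMap.mem_ker] at hy
  · rw [LinearMap.ker_rangeRestrict, ← hψ]
    refine le_antisymm ?_ ?_
    · rintro _ ⟨y, rfl⟩
      obtain ⟨s, rfl⟩ := hh y
      exact ⟨s, (hι s).symm⟩
    · rintro _ ⟨s, rfl⟩
      exact ⟨h s, hι s⟩

/-- The restriction of scalars of a module along a ring automorphism. -/
noncomputable abbrev twist {S : Type u} [Ring S] (σ : RingAut S) (X : ModuleCat.{u} S) :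
    ModuleCat.{u} S :=
  (ModuleCat.restrictScalars (RingEquiv.toRingHom σ)).obj X

/-- If the twist of `X` by `τ` is a second syzygy of `X`, then splicing the twisted sequences gives
a periodicity class from `X` to its twist by `τ ^ i`. -/
theorem hasPeriodicityClass_twist_pow {S : Type u} [Ring S] (τ : RingAut S) (X Z : ModuleCat.{u} S)
    (h₁ : IsSyzygy X Z) (h₂ : IsSyzygy Z (twist τ X)) (i : ℕ) :
    HasPeriodicityClass X (twist (τ ^ i) X) (2 * i) := by
  induction i with
  | zero => exact .of_iso (ModuleCat.restrictScalarsId'App _ (by ext; rfl) X).symm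
  | succ i ih =>
    let F := ModuleCat.restrictScalars.{u} (RingEquiv.toRingHom (τ ^ i))
    have h₃ := (h₁.map F).hasPeriodicityClass
    have h₄ := (h₂.map F).hasPeriodicityClass
    refine (ih.trans (h₃.trans h₄ rfl) rfl).trans (.of_iso ?_) rfl
    exact (ModuleCat.restrictScalarsComp'App (RingEquiv.toRingHom (τ ^ i)) (RingEquiv.toRingHom τ)
      (RingEquiv.toRingHom (τ ^ (i + 1))) (by rw [pow_succ']; rfl) X).symm

/-! ### The enveloping algebra and normal elements -/

section

variable {k : Type*} [CommRing k] {A C : Type*} [Ring A] [Algebra k A] [Ring C] [Algebra k C]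

theorem rTensor_mulLeft (a : A) (t : A ⊗[k] C) :
    (LinearMap.mulLeft k a).rTensor C t = a ⊗ₜ 1 * t := by
  induction t using TensorProduct.induction_on with
  | zero => simp
  | add r s hr hs => rw [map_add, hr, hs, mul_add]
  | tmul a b => simp

theorem lTensor_mulLeft (c : C) (t : A ⊗[k] C) :
    (LinearMap.mulLeft k c).lTensor A t = 1 ⊗ₜ c * t := by
  induction t using TensorProduct.induction_on with
  | zero => simp
  | add r s hr hs => rw [map_add, hr, hs, mul_add]
  | tmul a b => simp

end

noncomputable section Enveloping

open MulOpposite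

variable (k : Type v) [Field k] {A : Type u} [Ring A] [Algebra k A]

/-- The multiplication map `a ⊗ b ↦ a * b` of the enveloping algebra, as a map of bimodules. -/
def envMulLinear : EnvelopingAlgebra k A →ₗ[EnvelopingAlgebra k A] regularBimodule k A :=
  LinearMap.toSpanSingleton _ (regularBimodule k A) (1 : A)

/-- The multiplication map `a ⊗ b ↦ a * b` of the enveloping algebra, as an additive map to `A`. -/
def envMul : EnvelopingAlgebra k A →+ A :=
  (envMulLinear k).toAddMonoidHom

theorem tmul_smul_regularBimodule (a : A) (b : Aᵐᵒᵖ) (m : A) :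
    a ⊗ₜ[k] b • (show regularBimodule k A from m) = a * m * unop b := by
  let _ : Module (EnvelopingAlgebra k A) A := instModuleTensorProductMop k A
  exact (TensorProduct.Algebra.smul_def a b m).trans (by simp [mul_assoc])

@[simp]
theorem envMul_tmul (a : A) (b : Aᵐᵒᵖ) : envMul k (a ⊗ₜ b) = a * unop b :=
  (tmul_smul_regularBimodule k a b (1 : A)).trans (by rw [mul_one])

theorem envMul_tmul_mul (a : A) (b : Aᵐᵒᵖ) (r : EnvelopingAlgebra k A) :
    envMul k (a ⊗ₜ b * r) = a * envMul k r * unop b :=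
  ((envMulLinear k).map_smul (a ⊗ₜ b) r).trans (tmul_smul_regularBimodule k a b _)

theorem envMulLinear_surjective : Function.Surjective (envMulLinear k (A := A)) := fun (a : A) =>
  ⟨a ⊗ₜ 1, (envMul_tmul k a 1).trans (mul_one a)⟩

/-- The kernel of the multiplication map, as a left ideal of the enveloping algebra. -/
abbrev envKer (A : Type u) [Ring A] [Algebra k A] :
    Submodule (EnvelopingAlgebra k A) (EnvelopingAlgebra k A) :=
  LinearMap.ker (envMulLinear k (A := A))

variable {k} in
theorem mem_envKer {r : EnvelopingAlgebra k A} : r ∈ envKer k A ↔ envMul k r = 0 := Iff.rfl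

theorem projective_envKer (hA : HasProjectiveDimensionLE (regularBimodule k A) 1) :
    Module.Projective (EnvelopingAlgebra k A) (envKer k A) := by
  have hS := LinearMap.shortExact_shortComplexKer (envMulLinear_surjective k (A := A))
  have h₂ : Projective (ModuleCat.of (EnvelopingAlgebra k A) (EnvelopingAlgebra k A)) :=
    (IsProjective.iff_projective _).1 inferInstance
  have := hS.hasProjectiveDimensionLT_X₁ 1 (projective_iff_hasProjectiveDimensionLT_one.1 h₂) hA
  exact (IsProjective.iff_projective _).2 (projective_iff_hasProjectiveDimensionLT_one.2 this)

/-- The map of enveloping algebras induced by a map of algebras. -/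
abbrev envMap {B : Type u} [Ring B] [Algebra k B] (π : A →ₐ[k] B) :
    EnvelopingAlgebra k A →ₐ[k] EnvelopingAlgebra k B :=
  Algebra.TensorProduct.map π (AlgHom.op π)

theorem envMul_envMap {B : Type u} [Ring B] [Algebra k B] (π : A →ₐ[k] B)
    (r : EnvelopingAlgebra k A) : envMul k (envMap k π r) = π (envMul k r) := by
  induction r using TensorProduct.induction_on with
  | zero => simp only [map_zero]
  | add r s hr hs => simp only [map_add, hr, hs]
  | tmul a b =>
    simp

theorem envMap_surjective {B : Type u} [Ring B] [Algebra k B] (π : A →ₐ[k] B)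
    (hπ : Function.Surjective π) : Function.Surjective (envMap k π) :=
  TensorProduct.map_surjective hπ fun b => ⟨op (hπ (unop b)).choose, by
    simp [(hπ (unop b)).choose_spec]⟩

/-- The automorphism `α ⊗ 1` of the enveloping algebra. -/
abbrev envTwist (α : A ≃ₐ[k] A) : EnvelopingAlgebra k A ≃ₐ[k] EnvelopingAlgebra k A :=
  Algebra.TensorProduct.congr α AlgEquiv.refl

/-- The endomorphism `1 ⊗ α⁻¹` of the enveloping algebra. -/
abbrev envTwistRight (α : A ≃ₐ[k] A) : EnvelopingAlgebra k A →ₐ[k] EnvelopingAlgebra k A :=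
  Algebra.TensorProduct.map (AlgHom.id k A) (AlgHom.op (α.symm : A →ₐ[k] A))

theorem envMul_envTwistRight (α : A ≃ₐ[k] A) (r : EnvelopingAlgebra k A) :
    envMul k (envTwistRight k α r) = α.symm (envMul k (envTwist k α r)) := by
  induction r using TensorProduct.induction_on with
  | zero => simp only [map_zero]
  | add r s hr hs => simp only [map_add, hr, hs]
  | tmul a b => simp

variable {k}
variable {x : A} {α : A ≃ₐ[k] A} (hα : ∀ a : A, a * x = x * α a)

include hα

/-- `x ⊗ 1` is a normal element of the enveloping algebra. -/
theorem mul_tmul_one (r : EnvelopingAlgebra k A) :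
    r * (x ⊗ₜ 1) = (x ⊗ₜ 1) * envTwist k α r := by
  induction r using TensorProduct.induction_on with
  | zero => simp
  | add r s hr hs => rw [add_mul, hr, hs, map_add, mul_add]
  | tmul a b => simp [hα]

/-- `1 ⊗ x` is a normal element of the enveloping algebra. -/
theorem mul_one_tmul (r : EnvelopingAlgebra k A) :
    r * (1 ⊗ₜ op x) = (1 ⊗ₜ op x) * envTwistRight k α r := by
  induction r using TensorProduct.induction_on with
  | zero => simp
  | add r s hr hs => rw [add_mul, hr, hs, map_add, mul_add]
  | tmul a b =>
    have : b * op x = op x * op (α.symm (unop b)) := by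
      rw [← op_mul, hα, AlgEquiv.apply_symm_apply, op_mul, op_unop]
    simp [this]

end Enveloping

noncomputable section Quotient

open MulOpposite

variable (k : Type v) [Field k] {A : Type u} [Ring A] [Algebra k A] (x : A)

/-- The projection `A → A / (x)`. -/
abbrev quotientByMk : A →ₐ[k] QuotientBy x := RingCon.mkₐ k _

theorem quotientByMk_surjective : Function.Surjective (quotientByMk k x) :=
  RingCon.mk'_surjective _

theorem quotientByMk_eq_zero_iff_mem {a : A} :
    quotientByMk k x a = 0 ↔ a ∈ TwoSidedIdeal.span {x} := by
  conv_rhs => rw [← TwoSidedIdeal.ker_ringCon_mk' (TwoSidedIdeal.span {x})]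
  exact (TwoSidedIdeal.mem_ker _).symm

variable {k x}

theorem quotientByMk_self : quotientByMk k x x = 0 :=
  (quotientByMk_eq_zero_iff_mem k x).2 (TwoSidedIdeal.subset_span rfl)

variable {α : A ≃ₐ[k] A} (hα : ∀ a : A, a * x = x * α a)

include hα

theorem quotientByMk_eq_zero_iff {a : A} : quotientByMk k x a = 0 ↔ ∃ b, a = x * b := by
  rw [quotientByMk_eq_zero_iff_mem]
  constructor
  · intro h
    let I : TwoSidedIdeal A := .mk' {a | ∃ b, a = x * b} ⟨0, by simp⟩
      (by rintro _ _ ⟨b, rfl⟩ ⟨c, rfl⟩; exact ⟨b + c, (mul_add _ _ _).symm⟩)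
      (by rintro _ ⟨b, rfl⟩; exact ⟨-b, by simp⟩)
      (by rintro c _ ⟨b, rfl⟩; exact ⟨α c * b, by rw [← mul_assoc, hα, mul_assoc]⟩)
      (by rintro _ c ⟨b, rfl⟩; exact ⟨b * c, by rw [mul_assoc]⟩)
    have := TwoSidedIdeal.mem_span_iff.1 h I (by
      rintro _ rfl
      exact (TwoSidedIdeal.mem_mk' ..).2 ⟨1, (mul_one _).symm⟩)
    exact (TwoSidedIdeal.mem_mk' _ _ _ _ _ _ a).1 this
  · rintro ⟨b, rfl⟩
    exact TwoSidedIdeal.mul_mem_right _ _ _ (TwoSidedIdeal.subset_span rfl)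

theorem quotientByMk_eq_zero_iff' {a : A} : quotientByMk k x a = 0 ↔ ∃ b, a = b * x := by
  rw [quotientByMk_eq_zero_iff hα]
  exact ⟨fun ⟨b, h⟩ => ⟨α.symm b, by rw [h, hα, α.apply_symm_apply]⟩,
    fun ⟨b, h⟩ => ⟨α b, by rw [h, hα]⟩⟩

theorem exact_mulLeft_quotientByMk :
    Function.Exact (LinearMap.mulLeft k x) (quotientByMk k x).toLinearMap := fun _ =>
  (quotientByMk_eq_zero_iff hα).trans ⟨fun ⟨b, h⟩ => ⟨b, h.symm⟩, fun ⟨b, h⟩ => ⟨b, h.symm⟩⟩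

/-- The kernel of `Aᵉ → Bᵉ` is generated by `x ⊗ 1` and `1 ⊗ x`, already as a right ideal. -/
theorem envMap_quotientByMk_eq_zero {r : EnvelopingAlgebra k A}
    (h : envMap k (quotientByMk k x) r = 0) :
    ∃ b c, r = (x ⊗ₜ 1) * b + (1 ⊗ₜ op x) * c := by
  have hop : Function.Exact (LinearMap.mulLeft k (op x))
      (AlgHom.op (quotientByMk k x)).toLinearMap := fun _ => by
    refine Iff.trans ⟨fun h => congrArg unop h, fun h => congrArg op h⟩
      ((quotientByMk_eq_zero_iff' hα).trans
        ⟨fun ⟨b, h⟩ => ⟨op b, congrArg op h.symm⟩, fun ⟨b, h⟩ => ⟨unop b, congrArg unop h.symm⟩⟩)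
  have hsurj : Function.Surjective (AlgHom.op (quotientByMk k x)).toLinearMap := fun b =>
    ⟨op (quotientByMk_surjective k x (unop b)).choose,
      congrArg op (quotientByMk_surjective k x (unop b)).choose_spec⟩
  have hr : r ∈ LinearMap.ker (TensorProduct.map (quotientByMk k x).toLinearMap
      (AlgHom.op (quotientByMk k x)).toLinearMap) := h
  rw [TensorProduct.map_ker (exact_mulLeft_quotientByMk hα) (quotientByMk_surjective k x) hop hsurj,
    Submodule.mem_sup] at hr
  obtain ⟨_, ⟨c, rfl⟩, _, ⟨b, rfl⟩, rfl⟩ := hr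
  exact ⟨b, c, by rw [rTensor_mulLeft, lTensor_mulLeft, add_comm]⟩

end Quotient

/-! ### The second syzygy of the quotient bimodule -/

noncomputable section Periodicity

open MulOpposite

variable {k : Type v} [Field k] {A : Type u} [Ring A] [Algebra k A]
variable {x : A} {α : A ≃ₐ[k] A} (hα : ∀ a : A, a * x = x * α a)

/-- If `(x ⊗ 1) * t` vanishes in `A ⊗ Bᵒᵖ`, then so does `t`, because multiplication by `x` on `A` is
injective and stays so after tensoring over a field. In particular `t` vanishes in `Bᵉ`. -/
theorem envMap_eq_zero_of_tmul_mul_eq (hx : x ∈ nonZeroDivisors A) {t c : EnvelopingAlgebra k A}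
    (h : (x ⊗ₜ 1) * t = (1 ⊗ₜ op x) * c) : envMap k (quotientByMk k x) t = 0 := by
  let g : A ⊗[k] Aᵐᵒᵖ →ₐ[k] A ⊗[k] (QuotientBy x)ᵐᵒᵖ :=
    Algebra.TensorProduct.map (AlgHom.id k A) (AlgHom.op (quotientByMk k x))
  have hinj : Function.Injective
      ((LinearMap.mulLeft k x).rTensor (QuotientBy x)ᵐᵒᵖ) := by
    refine Module.Flat.rTensor_preserves_injective_linearMap _ fun a b hab => ?_
    exact (mul_cancel_left_mem_nonZeroDivisors hx).1 hab
  have hg : g t = 0 := by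
    refine hinj ?_
    rw [rTensor_mulLeft, map_zero]
    have := congrArg g h
    rw [map_mul, map_mul, Algebra.TensorProduct.map_tmul, Algebra.TensorProduct.map_tmul] at this
    rw [show AlgHom.op (quotientByMk k x) (op x) = 0 from congrArg op (quotientByMk_self (k := k)),
      TensorProduct.tmul_zero, zero_mul] at this
    exact this
  have : envMap k (quotientByMk k x) =
      (Algebra.TensorProduct.map (quotientByMk k x) (AlgHom.id k _)).comp g := by
    ext <;> simp [g]
  rw [this, AlgHom.comp_apply, hg, map_zero]

/-- The element `x ⊗ 1 - 1 ⊗ x`. -/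
abbrev envCommutator (k : Type v) [Field k] {A : Type u} [Ring A] [Algebra k A] (x : A) :
    EnvelopingAlgebra k A :=
  x ⊗ₜ 1 - 1 ⊗ₜ op x

theorem envCommutator_mem_envKer (y : A) : envCommutator k y ∈ envKer k A := by
  rw [mem_envKer]
  simp

include hα

theorem mul_envCommutator (a : EnvelopingAlgebra k A) :
    a * envCommutator k x =
      (x ⊗ₜ 1) * envTwist k α a - (1 ⊗ₜ op x) * envTwistRight k α a := by
  rw [mul_sub, mul_tmul_one hα, mul_one_tmul hα]

omit hα in
theorem tmul_mem_ker_envMap {y : A} (hy : quotientByMk k x y = 0) :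
    y ⊗ₜ 1 ∈ RingHom.ker (envMap k (quotientByMk k x)) ∧
      1 ⊗ₜ op y ∈ RingHom.ker (envMap k (quotientByMk k x)) := by
  simp [RingHom.mem_ker, hy]

omit hα in
theorem tmul_mul_add_mem {b c : EnvelopingAlgebra k A} (hb : b ∈ envKer k A)
    (hc : c ∈ envKer k A) : (x ⊗ₜ 1) * b + (1 ⊗ₜ op x) * c ∈
      RingHom.ker (envMap k (quotientByMk k x)) • envKer k A :=
  add_mem (Submodule.smul_mem_smul (tmul_mem_ker_envMap quotientByMk_self).1 hb)
    (Submodule.smul_mem_smul (tmul_mem_ker_envMap quotientByMk_self).2 hc)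

/-- Elements of `K J` have the form `(x ⊗ 1) b + (1 ⊗ x) c` with `b, c ∈ J`. -/
theorem mem_ker_smul_envKer {w : EnvelopingAlgebra k A}
    (hw : w ∈ RingHom.ker (envMap k (quotientByMk k x)) • envKer k A) :
    ∃ b ∈ envKer k A, ∃ c ∈ envKer k A, w = (x ⊗ₜ 1) * b + (1 ⊗ₜ op x) * c := by
  induction hw using Submodule.smul_induction_on' with
  | smul r hr j hj =>
    obtain ⟨b, c, rfl⟩ := envMap_quotientByMk_eq_zero hα (RingHom.mem_ker.1 hr)
    exact ⟨b * j, Submodule.smul_mem _ b hj, c * j, Submodule.smul_mem _ c hj, by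
      rw [smul_eq_mul, add_mul, mul_assoc, mul_assoc]⟩
  | add y hy z hz ihy ihz =>
    obtain ⟨b, hb, c, hc, rfl⟩ := ihy
    obtain ⟨b', hb', c', hc', rfl⟩ := ihz
    exact ⟨b + b', add_mem hb hb', c + c', add_mem hc hc', by rw [mul_add, mul_add]; abel⟩

/-- Modulo `K J`, every element of `J ∩ K` is a multiple of `x ⊗ 1 - 1 ⊗ x`. -/
theorem exists_sub_mul_envCommutator_mem (hx : x ∈ nonZeroDivisors A) {u : EnvelopingAlgebra k A}
    (hu : u ∈ envKer k A) (h : envMap k (quotientByMk k x) u = 0) :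
    ∃ a, u - a * envCommutator k x ∈ RingHom.ker (envMap k (quotientByMk k x)) • envKer k A := by
  obtain ⟨b, c, rfl⟩ := envMap_quotientByMk_eq_zero hα h
  have hμ : envMul k b + α (envMul k c) = 0 := by
    rw [mem_envKer, map_add, envMul_tmul_mul, envMul_tmul_mul] at hu
    rw [unop_one, mul_one, one_mul, unop_op, hα, ← mul_add] at hu
    exact (mul_cancel_left_mem_nonZeroDivisors hx).1 (hu.trans (mul_zero x).symm)
  -- With this multiplier the term `(x ⊗ 1) * b` cancels, and what remains lies in `(1 ⊗ x) J`.
  refine ⟨(envTwist k α).symm b, ?_⟩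
  have : (x ⊗ₜ 1) * b + (1 ⊗ₜ op x) * c - (envTwist k α).symm b * envCommutator k x =
      (x ⊗ₜ 1) * 0 + (1 ⊗ₜ op x) * (c + envTwistRight k α ((envTwist k α).symm b)) := by
    rw [mul_envCommutator hα, AlgEquiv.apply_symm_apply, mul_add, mul_zero]
    abel
  rw [this]
  refine tmul_mul_add_mem (zero_mem _) ?_
  rw [mem_envKer, map_add, envMul_envTwistRight, AlgEquiv.apply_symm_apply,
    eq_neg_of_add_eq_zero_left hμ, map_neg, AlgEquiv.symm_apply_apply, add_neg_cancel]

omit hα in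
/-- For `y, z ∈ I`, the elements `y z ⊗ 1` and `1 ⊗ y z` agree modulo `K J`. -/
theorem envCommutator_mul_mem {y z : A} (hy : quotientByMk k x y = 0)
    (hz : quotientByMk k x z = 0) : envCommutator k (y * z) ∈
      RingHom.ker (envMap k (quotientByMk k x)) • envKer k A := by
  have : envCommutator k (y * z) =
      (y ⊗ₜ 1) * envCommutator k z + (1 ⊗ₜ op z) * envCommutator k y := by
    simp [mul_sub]
  rw [this]
  exact add_mem
    (Submodule.smul_mem_smul (tmul_mem_ker_envMap hy).1 (envCommutator_mem_envKer z))
    (Submodule.smul_mem_smul (tmul_mem_ker_envMap hz).2 (envCommutator_mem_envKer y))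

/-- The annihilator of the class of `x ⊗ 1 - 1 ⊗ x` in `(J ∩ K) / K J`. -/
theorem mul_envCommutator_mem_iff (hx : x ∈ nonZeroDivisors A) (a : EnvelopingAlgebra k A) :
    a * envCommutator k x ∈ RingHom.ker (envMap k (quotientByMk k x)) • envKer k A ↔
      quotientByMk k x (envMul k (envTwist k α a)) = 0 := by
  constructor
  · intro h
    obtain ⟨b, hb, c, -, h⟩ := mem_ker_smul_envKer hα h
    rw [mul_envCommutator hα, sub_eq_iff_eq_add] at h
    have h' : (x ⊗ₜ 1) * (envTwist k α a - b) = (1 ⊗ₜ op x) * (c + envTwistRight k α a) := by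
      rw [mul_sub, h, mul_add]
      abel
    have := congrArg (envMul k) (envMap_eq_zero_of_tmul_mul_eq hx h')
    rwa [envMul_envMap, map_sub, mem_envKer.1 hb, sub_zero, map_zero] at this
  · intro h
    set y := envMul k (envTwist k α a) with hy
    have hxy : α.symm y * x = x * y := by rw [hα, AlgEquiv.apply_symm_apply]
    -- `(α ⊗ 1)(a)` and `(1 ⊗ α⁻¹)(a)` are moved into `J` by subtracting `y ⊗ 1` and `1 ⊗ α⁻¹(y)`;
    -- the error is the commutator of `x y ∈ I²`.
    have key : a * envCommutator k x = ((x ⊗ₜ 1) * (envTwist k α a - y ⊗ₜ 1) +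
        (1 ⊗ₜ op x) * (1 ⊗ₜ op (α.symm y) - envTwistRight k α a)) + envCommutator k (x * y) := by
      rw [mul_envCommutator hα, mul_sub, mul_sub, envCommutator,
        Algebra.TensorProduct.tmul_mul_tmul, Algebra.TensorProduct.tmul_mul_tmul,
        ← op_mul, hxy, mul_one, mul_one]
      abel
    rw [key]
    refine add_mem (tmul_mul_add_mem ?_ ?_) (envCommutator_mul_mem quotientByMk_self h)
    · rw [mem_envKer, map_sub, ← hy, envMul_tmul, unop_one, mul_one, sub_self]
    · rw [mem_envKer, map_sub, envMul_envTwistRight, ← hy, envMul_tmul, unop_op, one_mul, sub_self]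

/-- The automorphism of `A / (x)` induced by `α`, which exists because `α x = x`. -/
theorem exists_quotient_algEquiv (hx : x ∈ nonZeroDivisors A) :
    ∃ β : QuotientBy x ≃ₐ[k] QuotientBy x,
      ∀ a, β (quotientByMk k x a) = quotientByMk k x (α a) := by
  have hαx : α x = x := ((mul_cancel_left_mem_nonZeroDivisors hx).1 (hα x)).symm
  have hmem (a : A) : quotientByMk k x (α a) = 0 ↔ quotientByMk k x a = 0 := by
    rw [quotientByMk_eq_zero_iff hα, quotientByMk_eq_zero_iff hα]
    refine ⟨fun ⟨b, hb⟩ => ⟨α.symm b, α.injective ?_⟩, fun ⟨b, hb⟩ => ⟨α b, ?_⟩⟩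
    · rw [hb, map_mul, hαx, α.apply_symm_apply]
    · rw [hb, map_mul, hαx]
  let e := RingCon.congr (c := (TwoSidedIdeal.span {x}).ringCon)
    (d := (TwoSidedIdeal.span {x}).ringCon) (α : A ≃+* A) (by
      ext a b
      rw [RingCon.comap_rel, TwoSidedIdeal.rel_iff, TwoSidedIdeal.rel_iff,
        ← quotientByMk_eq_zero_iff_mem k, ← quotientByMk_eq_zero_iff_mem k, ← hmem, map_sub α]
      rfl)
  exact ⟨AlgEquiv.ofRingEquiv (f := e) fun r => congrArg (quotientByMk k x) (α.commutes r),
    fun a => rfl⟩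

end Periodicity

/-! ### Finite generation of Yoneda algebras and modules -/

section FiniteGeneration
universe w' v' u' t
variable {C : Type u'} [Category.{v'} C] [Abelian C] [HasExt.{w'} C]

theorem of_mul_of_yoneda {X : C} {i j l : ℕ} (a : Ext X X i) (b : Ext X X j) (h : i + j = l) :
    DirectSum.of (Ext X X) i a * DirectSum.of (Ext X X) j b =
      DirectSum.of (Ext X X) l (a.comp b h) := by
  subst h
  exact DirectSum.of_mul_of a b

theorem of_smul_of_yoneda {X Y : C} {i j l : ℕ} (a : Ext X X i) (b : Ext X Y j) (h : i + j = l) :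
    DirectSum.of (Ext X X) i a • DirectSum.of (Ext X Y) j b =
      DirectSum.of (Ext X Y) l (a.comp b h) := by
  subst h
  exact DirectSum.Gmodule.of_smul_of _ _ a b

variable {k : Type t} [Field k] [Linear k C]

/-- If every class of degree above `d` is a multiple of `ξ`, then the Yoneda algebra is generated
by its components of degree at most `d`. -/
theorem finiteType_yoneda {X : C} {d : ℕ} (ξ : Ext X X d) (hd : 0 < d)
    (hξ : ∀ p q (h : d + p = q), 1 ≤ p → Function.Surjective fun s : Ext X X p => ξ.comp s h)
    (hfin : ∀ p, Module.Finite k (Ext X X p)) : Algebra.FiniteType k (⨁ p, Ext X X p) := by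
  choose T hT using fun p => (hfin p).fg_top
  classical
  let G : Finset (⨁ p, Ext X X p) :=
    (Finset.range (d + 1)).biUnion fun p => (T p).image (DirectSum.of (Ext X X) p)
  let U := Algebra.adjoin k (G : Set (⨁ p, Ext X X p))
  have hU : ∀ p (hp : p ≤ d) (a : Ext X X p), DirectSum.of (Ext X X) p a ∈ U := by
    intro p hp a
    have ha : a ∈ Submodule.span k (T p : Set (Ext X X p)) := by rw [hT]; trivial
    induction ha using Submodule.span_induction with
    | mem t ht =>
      exact Algebra.subset_adjoin (Finset.mem_biUnion.2
        ⟨p, Finset.mem_range.2 (by omega), Finset.mem_image_of_mem _ ht⟩)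
    | zero => rw [map_zero]; exact zero_mem U
    | add y z _ _ hy hz => rw [map_add]; exact add_mem hy hz
    | smul c y _ hy =>
      have : DirectSum.of (Ext X X) p (c • y) = c • DirectSum.of (Ext X X) p y :=
        (DirectSum.lof k ℕ (Ext X X) p).map_smul c y
      rw [this]
      exact U.smul_mem hy c
  refine ⟨⟨G, eq_top_iff.2 fun z _ => ?_⟩⟩
  induction z using DirectSum.induction_on with
  | zero => exact zero_mem U
  | add y z hy hz => exact add_mem (hy trivial) (hz trivial)
  | of p a =>
    induction p using Nat.strong_induction_on with
    | _ p ih =>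
      by_cases hp : p ≤ d
      · exact hU p hp a
      · obtain ⟨b, rfl⟩ := hξ (p - d) p (by omega) (by omega) a
        dsimp only
        rw [← of_mul_of_yoneda ξ b]
        exact mul_mem (hU d le_rfl ξ) (ih (p - d) (by omega) b trivial)

/-- If every class of degree above `d` is a multiple of `ξ`, then the Yoneda module is generated
by its components of degree at most `d`. -/
theorem finite_yonedaModule {X Y : C} {d : ℕ} (ξ : Ext X X d) (hd : 0 < d)
    (hξ : ∀ p q (h : d + p = q), 1 ≤ p → Function.Surjective fun s : Ext X Y p => ξ.comp s h)
    (hfin : ∀ p, Module.Finite k (Ext X Y p)) :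
    Module.Finite (⨁ p, Ext X X p) (⨁ p, Ext X Y p) := by
  choose T hT using fun p => (hfin p).fg_top
  classical
  let G : Finset (⨁ p, Ext X Y p) :=
    (Finset.range (d + 1)).biUnion fun p => (T p).image (DirectSum.of (Ext X Y) p)
  let U := Submodule.span (⨁ p, Ext X X p) (G : Set (⨁ p, Ext X Y p))
  have hU : ∀ p (hp : p ≤ d) (a : Ext X Y p), DirectSum.of (Ext X Y) p a ∈ U := by
    intro p hp a
    have ha : a ∈ Submodule.span k (T p : Set (Ext X Y p)) := by rw [hT]; trivial
    induction ha using Submodule.span_induction with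
    | mem t ht =>
      exact Submodule.subset_span (Finset.mem_biUnion.2
        ⟨p, Finset.mem_range.2 (by omega), Finset.mem_image_of_mem _ ht⟩)
    | zero => rw [map_zero]; exact zero_mem U
    | add y z _ _ hy hz => rw [map_add]; exact add_mem hy hz
    | smul c y _ hy =>
      -- Scalars act through the degree zero part of the Yoneda algebra.
      have : c • y = (c • Ext.mk₀ (𝟙 X)).comp y (zero_add p) := by
        rw [Ext.smul_comp, Ext.mk₀_id_comp]
      rw [this, ← of_smul_of_yoneda]
      exact U.smul_mem _ hy
  refine ⟨⟨G, eq_top_iff.2 fun z _ => ?_⟩⟩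
  induction z using DirectSum.induction_on with
  | zero => exact zero_mem U
  | add y z hy hz => exact add_mem (hy trivial) (hz trivial)
  | of p a =>
    induction p using Nat.strong_induction_on with
    | _ p ih =>
      by_cases hp : p ≤ d
      · exact hU p hp a
      · obtain ⟨b, rfl⟩ := hξ (p - d) p (by omega) (by omega) a
        dsimp only
        rw [← of_smul_of_yoneda ξ b]
        exact U.smul_mem _ (ih (p - d) (by omega) b trivial)

end FiniteGeneration

/-- `Ext` groups over a finite-dimensional algebra between finitely generated modules are
finite-dimensional, by dimension shifting along `0 → ker g → Sᵐ → N → 0`. -/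
theorem finite_ext_of_finite_algebra (k : Type v) [Field k] {S : Type u} [Ring S] [Algebra k S]
    [Module.Finite k S] (N M : ModuleCat.{u} S) [Module.Finite S N] [Module.Finite k M] (i : ℕ) :
    Module.Finite k (Ext N M i) := by
  have : IsNoetherianRing S := isNoetherian_of_tower k inferInstance
  induction i generalizing N with
  | zero =>
    have : Module.Finite k N := Module.Finite.trans S N
    let l : (N ⟶ M) →ₗ[k] (N →ₗ[k] M) :=
      { toFun := fun f => f.hom.restrictScalars k
        map_add' := fun f g => rfl
        map_smul' := fun c f => rfl }
    have hl : Function.Injective l := fun f g h => by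
      ext y
      exact LinearMap.congr_fun h y
    have := Module.Finite.of_injective l hl
    exact Module.Finite.equiv Ext.linearEquiv₀.symm
  | succ i ih =>
    obtain ⟨m, g, hg⟩ := Module.Finite.exists_fin' S N
    have hS := LinearMap.shortExact_shortComplexKer hg
    have : Projective (ModuleCat.of S (Fin m → S)) :=
      (IsProjective.iff_projective _).1 inferInstance
    have := ih (ModuleCat.of S (LinearMap.ker g))
    exact Module.Finite.of_surjective (hS.extClass.precompOfLinear k M (add_comm 1 i))
      (precomp_extClass_surjective_of_projective_X₂ M hS i)

/-! ### Periodicity of Hochschild cohomology -/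

noncomputable section Main
variable {k : Type v} [Field k] {A : Type u} [Ring A] [Algebra k A]

/-- The class of the exact sequence of length `2 n` from `B = A / (x)` to itself that is spliced
from `n` twisted copies of `0 → B' → P → Bᵉ → B → 0`. -/
theorem hasPeriodicityClass_quotientBy (hA : HasProjectiveDimensionLE (regularBimodule k A) 1)
    {x : A} (hx : x ∈ nonZeroDivisors A) {α : A ≃ₐ[k] A} (hα : ∀ a : A, a * x = x * α a)
    {n : ℕ} (hαn : α ^ n = 1) :
    HasPeriodicityClass (regularBimodule k (QuotientBy x)) (regularBimodule k (QuotientBy x))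
      (2 * n) := by
  obtain ⟨β, hβ⟩ := exists_quotient_algEquiv hα hx
  have := projective_envKer k hA
  have hf := envMap_surjective k _ (quotientByMk_surjective k x)
  let f : EnvelopingAlgebra k A →+* EnvelopingAlgebra k (QuotientBy x) :=
    (envMap k (quotientByMk k x)).toRingHom
  let τ : RingAut (EnvelopingAlgebra k (QuotientBy x)) := (envTwist k β).toRingEquiv
  have hτ (r) : τ (f r) = f (envTwist k α r) := by
    induction r using TensorProduct.induction_on with
    | zero => simp only [map_zero]
    | add r s hr hs => simp only [map_add, hr, hs]
    | tmul a b => exact congrArg (· ⊗ₜ[k] AlgHom.op (quotientByMk k x) b) (hβ a)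
  let X := regularBimodule k (QuotientBy x)
  let h : EnvelopingAlgebra k (QuotientBy x) →ₗ[EnvelopingAlgebra k (QuotientBy x)] twist τ X :=
    LinearMap.toSpanSingleton _ (twist τ X) (1 : QuotientBy x)
  -- `h` sends `s` to the action of `τ s` on `1`, so its kernel is the annihilator found above.
  have hh (s) : h s = envMulLinear k (τ s) := rfl
  have hmem (a) : a * envCommutator k x ∈ RingHom.ker f • envKer k A ↔ f a ∈ LinearMap.ker h := by
    refine (mul_envCommutator_mem_iff hα hx a).trans ?_
    rw [LinearMap.mem_ker, hh, hτ, ← envMul_envMap]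
    rfl
  have hfe : f (envCommutator k x) = 0 := RingHom.mem_ker.1
    (sub_mem (tmul_mem_ker_envMap quotientByMk_self).1
      (tmul_mem_ker_envMap quotientByMk_self).2)
  obtain ⟨P, _, _, φ, ψ, hP, hφ, hψ, hker⟩ := exists_presentation_baseChange f hf (envKer k A)
    (envCommutator k x) (envCommutator_mem_envKer x) hfe (LinearMap.ker h)
    (fun u hu hu0 => exists_sub_mul_envCommutator_mem hα hx hu hu0) hmem
  have hrange : LinearMap.range φ = LinearMap.ker (envMulLinear k (A := QuotientBy x)) := by
    ext s
    rw [hφ, LinearMap.mem_ker]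
    constructor
    · rintro ⟨u, hu, rfl⟩
      refine (envMul_envMap k (quotientByMk k x) u).trans ?_
      rw [mem_envKer.1 hu, map_zero]
      rfl
    · intro hs
      obtain ⟨u, rfl⟩ := hf s
      have hu : quotientByMk k x (envMul k u) = 0 :=
        (envMul_envMap k (quotientByMk k x) u).symm.trans hs
      refine ⟨u - envMul k u ⊗ₜ 1, ?_, ?_⟩
      · rw [mem_envKer]; simp
      · rw [map_sub, show f (envMul k u ⊗ₜ 1) = 0 from
          RingHom.mem_ker.1 (tmul_mem_ker_envMap hu).1, sub_zero]
        rfl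
  have hhs : Function.Surjective h := fun b => by
    obtain ⟨s, hs⟩ := envMulLinear_surjective k (A := QuotientBy x) b
    exact ⟨τ.symm s, by rw [hh, RingEquiv.apply_symm_apply, hs]⟩
  obtain ⟨Z, h₁, h₂⟩ := exists_isSyzygy_isSyzygy (envMulLinear k) φ ψ h
    (envMulLinear_surjective k) hhs hrange hψ hker
  have hτn : τ ^ n = 1 := by
    have hpow (i : ℕ) (a b) : (τ ^ i) (f (a ⊗ₜ b)) = f ((α ^ i) a ⊗ₜ b) := by
      induction i with
      | zero => simp
      | succ i ih =>
        rw [pow_succ', pow_succ', RingAut.mul_apply, ih, hτ]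
        simp
    ext s
    obtain ⟨r, rfl⟩ := hf s
    change (τ ^ n) (f r) = f r
    induction r using TensorProduct.induction_on with
    | zero => simp only [map_zero]
    | add r s hr hs => simp only [map_add, hr, hs]
    | tmul a b => rw [hpow, hαn]; rfl
  have := hasPeriodicityClass_twist_pow τ X Z h₁ h₂ n
  rw [hτn] at this
  exact this.trans (.of_iso (ModuleCat.restrictScalarsId'App _ rfl X)) rfl

end Main

theorem mainTheorem11 (k : Type v) [Field k] (A : Type u) [Ring A] [Algebra k A]
    (hA : HasProjectiveDimensionLE (regularBimodule k A) 1)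
    (x : A) (hx : IsNormalElement x) (hx' : x ∈ nonZeroDivisors A)
    (α : A ≃ₐ[k] A) (hα : ∀ a : A, a * x = x * α a)
    (n : ℕ) (hn : 1 ≤ n) (hαn : α ^ n = 1) :
    (∃ ξ : HH k (QuotientBy x) (2 * n),
      ∀ (p : ℕ), 1 ≤ p → ∀ M : BimoduleCat k (QuotientBy x), Function.Bijective (cupWith ξ M p)) ∧
    (Module.Finite k (QuotientBy x) →
      Algebra.FiniteType k (HHAlgebra k (QuotientBy x)) ∧
      ∀ M : BimoduleCat k (QuotientBy x), Module.Finite k M →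
        Module.Finite (HHAlgebra k (QuotientBy x)) (HochschildModule k (QuotientBy x) M)) := by
  obtain ⟨ξ, hξ⟩ := hasPeriodicityClass_quotientBy hA hx' hα hαn
  refine ⟨⟨ξ, fun p hp M => hξ p _ (add_comm _ _) hp M⟩, fun hfin => ?_⟩
  have hS : Module.Finite (EnvelopingAlgebra k (QuotientBy x))
      (regularBimodule k (QuotientBy x)) :=
    Module.Finite.of_surjective _ (envMulLinear_surjective k)
  have hE : Module.Finite k (EnvelopingAlgebra k (QuotientBy x)) :=
    have : Module.Finite k (QuotientBy x)ᵐᵒᵖ :=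
      Module.Finite.equiv (MulOpposite.opLinearEquiv k)
    inferInstance
  have hX : Module.Finite k (regularBimodule k (QuotientBy x)) :=
    Module.Finite.trans (EnvelopingAlgebra k (QuotientBy x)) _
  exact ⟨finiteType_yoneda (k := k) ξ (by omega) (fun p q h hp => (hξ p q h hp _).2)
      fun p => finite_ext_of_finite_algebra k _ _ p,
    fun M hM => finite_yonedaModule (k := k) ξ (by omega) (fun p q h hp => (hξ p q h hp M).2)
      fun p => finite_ext_of_finite_algebra k _ _ p⟩
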